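/- Let $\mathbf{B}=(b_{i,j})$ be an $n_c\times n_v$ matrix of non-negative integers, regarded as a protograph: a bipartite multigraph with check nodes $c_1,\dots,c_{n_c}$, variable nodes $v_1,\dots,v_{n_v}$ and $b_{i,j}$ parallel edges between $c_i$ and $v_j$. Let a set of $x\ge 0$ of the variable nodes be chosen to be partially doped, and let $\mathcal C$ be a $(\mu,\kappa)$ binary Hamming code, i.e. $\mu=2^r-1$, $\kappa=\mu-r$ with $r\ge 2$, and $\mathcal C$ has a parity-check matrix whose columns are the nonzero vectors of $\{0,1\}^r$, each exactly once. For $N=\mu\beta$, a code of the $(\mathbf{B},\mu,\kappa,N,x)$ protograph-based PD-GLDPC ensemble has block length $n=n_vN$ and is obtained as follows. Take $N$ copies of the protograph and, for each edge $e$ between $c_i$ and $v_j$, permute the $N$ copies of $e$ among the copies of $c_i$ and $v_j$ by a permutation $\pi_e$, the $\pi_e$ being independent and uniformly random. A binary word, with one symbol on each copy of each variable node, is a codeword if the symbols at each copy of each check node (counted with multiplicity) sum to $0$ modulo $2$, and if, for each doped variable node, each of the $\beta$ consecutive blocks of $\mu$ of its $N$ copies carries a codeword of $\mathcal C$. Suppose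 that every undoped variable node has degree at least $2$, that every doped variable node has degree at least $1$, and that the undoped variable nodes of degree $2$ form no cycle among themselves in the protograph, that is, the sub-multigraph consisting of the undoped variable nodes of degree $2$, their edges and the check nodes contains no cycle (a pair of parallel edges counts as a cycle). Then the ensemble has a typical minimum distance that grows linearly with the block length: there is a constant $\delta>0$, depending only on $\mathbf{B}$, the set of doped nodes and $\mathcal C$, such that $$\Pr\bigl[d_{\min}<\delta\, n_v N\bigr]\longrightarrow 0\qquad\text{as } N=\mu\beta\to\infty,$$ where $d_{\min}$ is the least Hamming weight of a nonzero codeword ($d_{\min}=\infty$ for the zero code). -/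

import Mathlib

open Filter Topology
open scoped ENNReal

namespace PDGLDPC

/-- The degree of the variable node `j` of the protograph with base matrix `B` (rows are check
nodes, columns are variable nodes, entries are numbers of parallel edges). -/
def varDegree {nc nv : ℕ} (B : Matrix (Fin nc) (Fin nv) ℕ) (j : Fin nv) : ℕ :=
  ∑ i, B i j

/-- The edges of the protograph: `⟨i, j, k⟩` is the `k`-th of the `B i j` parallel edges between
the check node `i` and the variable node `j`. -/
abbrev Edge {nc nv : ℕ} (B : Matrix (Fin nc) (Fin nv) ℕ) : Type :=
  Σ i : Fin nc, Σ j : Fin nv, Fin (B i j)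

/-- The variable node `j` is not doped (`D` is the set of the partially doped variable nodes) and
has degree two. -/
def IsUndopedDegTwo {nc nv : ℕ} (B : Matrix (Fin nc) (Fin nv) ℕ) (D : Finset (Fin nv))
    (j : Fin nv) : Prop :=
  j ∉ D ∧ varDegree B j = 2

/-- The simple bipartite graph on variable and check nodes that keeps only the adjacencies of the
undoped variable nodes of degree two. -/
def undopedDegTwoGraph {nc nv : ℕ} (B : Matrix (Fin nc) (Fin nv) ℕ) (D : Finset (Fin nv)) :
    SimpleGraph (Fin nv ⊕ Fin nc) :=
  SimpleGraph.fromRel fun a b =>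
    ∃ j i, a = Sum.inl j ∧ b = Sum.inr i ∧ IsUndopedDegTwo B D j ∧ B i j ≠ 0

/-- The undoped variable nodes of degree two form no cycle among themselves in the protograph.
The protograph is a multigraph: a cycle is either a pair of parallel edges, or a cycle of the
underlying simple graph. -/
def NoUndopedDegTwoCycle {nc nv : ℕ} (B : Matrix (Fin nc) (Fin nv) ℕ) (D : Finset (Fin nv)) :
    Prop :=
  (∀ i j, IsUndopedDegTwo B D j → B i j ≤ 1) ∧ (undopedDegTwoGraph B D).IsAcyclic

/-- The columns of `H` are the nonzero binary vectors of length `r`, each exactly once. -/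
def IsHammingCheckMatrix {r μ : ℕ} (H : Matrix (Fin r) (Fin μ) (ZMod 2)) : Prop :=
  Function.Injective H.col ∧ Set.range H.col = {v | v ≠ 0}

/-- `C` is a `(μ, κ)` Hamming code (so `μ = 2 ^ r - 1` and `κ = μ - r` with `r ≥ 2`). -/
def IsHammingCode {μ : ℕ} (κ : ℕ) (C : Submodule (ZMod 2) (Fin μ → ZMod 2)) : Prop :=
  ∃ r : ℕ, 2 ≤ r ∧ κ + r = μ ∧ ∃ H : Matrix (Fin r) (Fin μ) (ZMod 2),
    IsHammingCheckMatrix H ∧ ∀ w, w ∈ C ↔ H.mulVec w = 0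

/-- The `N = β * μ` copies of a protograph node or edge, arranged in `β` blocks of length `μ`. -/
abbrev Copy (μ β : ℕ) : Type := Fin β × Fin μ

/-- A lifting of the protograph by `N = β * μ`: one permutation of the copies for every edge. The
copy of the edge `e` that starts at the variable copy `s` ends at the check copy `π e s`. -/
abbrev Lifting {nc nv : ℕ} (B : Matrix (Fin nc) (Fin nv) ℕ) (μ β : ℕ) : Type :=
  Edge B → Equiv.Perm (Copy μ β)

/-- The PD-GLDPC code of a lifting. Every copy of every check node is a single parity check on the
symbols at the ends of its edge copies, and, for every doped variable node, each of the `β` blocks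
of its `N` copies is a codeword of the component code `C`. -/
def code {nc nv : ℕ} {B : Matrix (Fin nc) (Fin nv) ℕ} (D : Finset (Fin nv)) {μ β : ℕ}
    (C : Submodule (ZMod 2) (Fin μ → ZMod 2)) (π : Lifting B μ β) :
    Submodule (ZMod 2) (Fin nv × Copy μ β → ZMod 2) where
  carrier := {c |
    (∀ (i : Fin nc) (s : Copy μ β),
      ∑ j : Fin nv, ∑ k : Fin (B i j), c (j, (π ⟨i, j, k⟩).symm s) = 0) ∧
    ∀ j ∈ D, ∀ b : Fin β, (fun t : Fin μ => c (j, (b, t))) ∈ C}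
  add_mem' := by
    rintro a c ⟨ha, ha'⟩ ⟨hc, hc'⟩
    refine ⟨fun i s => ?_, fun j hj b => C.add_mem (ha' j hj b) (hc' j hj b)⟩
    simp only [Pi.add_apply, Finset.sum_add_distrib, ha i s, hc i s, add_zero]
  zero_mem' := ⟨fun i s => by simp, fun j hj b => C.zero_mem⟩
  smul_mem' := by
    rintro a c ⟨hc, hc'⟩
    refine ⟨fun i s => ?_, fun j hj b => C.smul_mem a (hc' j hj b)⟩
    simp only [Pi.smul_apply, ← Finset.smul_sum, hc i s, smul_zero]

/-- The minimum distance of a binary linear code: the least Hamming weight of a nonzero codeword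
(`⊤` for the zero code). -/
noncomputable def minDist {ι : Type*} [Fintype ι] (C : Submodule (ZMod 2) (ι → ZMod 2)) : ℕ∞ :=
  ⨅ c ∈ C, ⨅ _ : c ≠ 0, (hammingNorm c : ℕ∞)

/-- The probability of the event `P` for a uniformly random lifting, that is, for independent
uniformly random permutations on the edges of the protograph. -/
noncomputable def liftingProb {nc nv : ℕ} (B : Matrix (Fin nc) (Fin nv) ℕ) (μ β : ℕ)
    (P : Lifting B μ β → Prop) : ℝ :=
  (Nat.card {π : Lifting B μ β // P π} : ℝ) / Nat.card (Lifting B μ β)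

/-- The PD-GLDPC ensemble has a typical minimum distance: for some `δ > 0`, the probability that
the minimum distance is smaller than `δ` times the block length `nv * N` tends to zero as
`N = β * μ` tends to infinity. -/
def HasTypicalMinDist {nc nv : ℕ} (B : Matrix (Fin nc) (Fin nv) ℕ) (D : Finset (Fin nv)) {μ : ℕ}
    (C : Submodule (ZMod 2) (Fin μ → ZMod 2)) : Prop :=
  ∃ δ : ℝ, 0 < δ ∧
    Tendsto (fun β : ℕ => liftingProb B μ β fun π =>
      (minDist (code D C π) : ℝ≥0∞) < ENNReal.ofReal (δ * (nv * (β * μ)))) atTop (𝓝 0)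

end PDGLDPC

/-! First moment method. Fix a word with weights `d j` on the variable nodes and total weight `w`,
and put `N = β * μ`, `t = w / N`. Record at each check copy which incident edges carry a 1. For a
fixed pattern the independent permutations realise it with probability at most `∏ e, 1 / N.choose (d
j)`, where `j` is the variable end of `e`. A satisfied check never sees exactly one 1, so at most
half as many check copies as there are active edge copies are touched. Hence there are at most `exp
(O(w)) * t ^ (-(∑ e, d j) / 2)` patterns (`card_satisfiesChecks_mul_le`, `card_sparse_mul_rpow_le`).

The words on an undoped node number at most `N.choose d`. On a doped node each nonzero block has
weight at least 3, which leaves at most `exp (O(w)) * t ^ (-d / 3)` words. Since `N.choose d * t ^ d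
≥ 1`, every node contributes a factor at most `t ^ (d / 6)` up to `exp (O(w))`, except undoped nodes
of degree two, which contribute no power of `t` (`nodeWordCount_le`).

Those exceptional nodes form a forest, so the checks prevent them from carrying nearly all the
weight: the others carry at least `ε * w` (`exists_sum_le_of_isBalanced`). The expected count at
weight `w` is thus at most `(K * t ^ a) ^ w`, and its sum over `0 < w < x * N` tends to 0 for small
`x`. -/

namespace PDGLDPC

/-! ### Counting estimates -/

/-- A fixed finite set is sent to a given set of the same size by the fraction
`1 / (card α).choose #s` of all permutations. -/
theorem card_perm_map_eq_mul_choose_le {α : Type*} [Fintype α] [DecidableEq α] (s A : Finset α) :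
    Fintype.card {σ : Equiv.Perm α // s.map σ.toEmbedding = A} * (Fintype.card α).choose s.card
      ≤ (Fintype.card α).factorial := by
  classical
  by_cases hA : A.card = s.card
  swap
  · have : IsEmpty {σ : Equiv.Perm α // s.map σ.toEmbedding = A} :=
      ⟨fun σ => hA (by rw [← σ.2, Finset.card_map])⟩
    simp
  have key : ∀ A' ∈ Finset.powersetCard s.card (Finset.univ : Finset α),
      (Finset.univ.filter fun σ : Equiv.Perm α => s.map σ.toEmbedding = A').card
        = Fintype.card {σ : Equiv.Perm α // s.map σ.toEmbedding = A} := by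
    intro A' hA'
    have hcard : A'.card = A.card := by rw [hA, (Finset.mem_powersetCard.1 hA').2]
    -- Composition with a permutation taking `A'` to `A` matches the two fibres, so all fibres have
    -- the same size.
    let τ : Equiv.Perm α := (Finset.equivOfCardEq hcard).extendSubtype
    have hτ : A'.map τ.toEmbedding = A := by
      refine Finset.eq_of_subset_of_card_le ?_ (by rw [Finset.card_map, hcard])
      intro x hx
      obtain ⟨y, hy, rfl⟩ := Finset.mem_map.1 hx
      exact (Finset.equivOfCardEq hcard).extendSubtype_mem y hy
    rw [Fintype.card_subtype]
    refine Finset.card_bij' (fun σ _ => σ.trans τ) (fun σ _ => σ.trans τ.symm) ?_ ?_ ?_ ?_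
    · intro σ hσ
      simp only [Finset.mem_filter, Finset.mem_univ, true_and] at hσ ⊢
      rw [← hτ, ← hσ, Finset.map_map]; rfl
    · intro σ hσ
      simp only [Finset.mem_filter, Finset.mem_univ, true_and] at hσ ⊢
      rw [← Finset.map_inj (f := τ.toEmbedding), hτ, ← hσ, Finset.map_map]
      congr 1; ext; simp
    · intro σ _; ext; simp
    · intro σ _; ext; simp
  have hsum := Finset.card_eq_sum_card_fiberwise (s := (Finset.univ : Finset (Equiv.Perm α)))
    (t := Finset.powersetCard s.card (Finset.univ : Finset α))
    (f := fun σ => s.map σ.toEmbedding) (by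
      intro σ _
      simp [Finset.mem_powersetCard])
  rw [Finset.sum_congr rfl key, Finset.sum_const, Finset.card_powersetCard, Finset.card_univ,
    Finset.card_univ, Fintype.card_perm, smul_eq_mul, mul_comm] at hsum
  exact hsum.ge

/-- A Chernoff-type bound for the number of functions that differ from a constant `y₀` in at most
`d / k` places. -/
theorem card_sparse_mul_rpow_le {X Y : Type*} [Fintype X] [DecidableEq X] [Fintype Y]
    [DecidableEq Y] (y₀ : Y) {k : ℕ} (hk : 0 < k) (d : ℕ) {t : ℝ} (ht : 0 < t) (ht1 : t ≤ 1) :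
    (Fintype.card {g : X → Y // k * (Finset.univ.filter fun x => g x ≠ y₀).card ≤ d} : ℝ)
      * t ^ ((d : ℝ) / k) ≤ Real.exp (Fintype.card Y * Fintype.card X * t) := by
  -- The generating function of the support size factors over `X`. Since `t ≤ 1`, each sparse `g`
  -- contributes at least `t ^ (d / k)` to it.
  have hall : ∑ g : X → Y, t ^ (Finset.univ.filter fun x => g x ≠ y₀).card
      ≤ Real.exp (Fintype.card Y * Fintype.card X * t) := by
    have h1 : ∀ g : X → Y, t ^ (Finset.univ.filter fun x => g x ≠ y₀).card
        = ∏ x, (if g x ≠ y₀ then t else 1) := by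
      intro g
      rw [Finset.prod_ite]; simp
    simp_rw [h1]
    rw [← Fintype.prod_sum fun (_ : X) (y : Y) => if y ≠ y₀ then t else 1]
    have h2 : ∑ y : Y, (if y ≠ y₀ then t else 1) ≤ Real.exp (Fintype.card Y * t) := by
      refine le_trans ?_ (Real.add_one_le_exp _)
      calc ∑ y : Y, (if y ≠ y₀ then t else 1) ≤ ∑ y : Y, (t + if y = y₀ then 1 else 0) := by
            refine Finset.sum_le_sum fun y _ => ?_
            split_ifs <;> simp_all; linarith
        _ = Fintype.card Y * t + 1 := by
            rw [Finset.sum_add_distrib]; simp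
    calc _ ≤ ∏ _x : X, Real.exp (Fintype.card Y * t) := by
          refine Finset.prod_le_prod (fun x _ => Finset.sum_nonneg fun y _ => ?_) fun x _ => h2
          split_ifs <;> positivity
      _ = _ := by
          rw [Finset.prod_const, Finset.card_univ, ← Real.exp_nat_mul]; ring_nf
  refine le_trans ?_ hall
  rw [Fintype.card_subtype, ← nsmul_eq_mul, ← Finset.sum_const]
  refine le_trans (Finset.sum_le_sum fun g hg => ?_)
    (Finset.sum_le_sum_of_subset_of_nonneg (Finset.filter_subset _ _) fun g _ _ => by positivity)
  rw [← Real.rpow_natCast]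
  refine Real.rpow_le_rpow_of_exponent_ge ht ht1 ?_
  rw [le_div_iff₀ (by positivity), mul_comm]
  exact_mod_cast (Finset.mem_filter.1 hg).2

/-- The binomial coefficient is the product of the ratios `(n - i) / (d - i)` for `i < d`, each at
least `n / d`. In the induction this is `(n + 1) * d ≤ (d + 1) * n`. -/
theorem pow_le_choose_mul_pow {n d : ℕ} (h : d ≤ n) : n ^ d ≤ n.choose d * d ^ d := by
  induction d generalizing n with
  | zero => simp
  | succ d ih =>
    obtain _ | n := n
    · omega
    have hd : d ≤ n := by omega
    have h1 := Nat.add_one_mul_choose_eq n d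
    obtain rfl | hd0 := Nat.eq_zero_or_pos d
    · simp
    have h2 : ((n + 1) * d) ^ d ≤ ((d + 1) * n) ^ d := Nat.pow_le_pow_left (by nlinarith) d
    have h3 := ih hd
    have h4 : (n + 1) ^ d * d ^ d ≤ (d + 1) ^ d * n.choose d * d ^ d := by
      calc (n + 1) ^ d * d ^ d ≤ (d + 1) ^ d * n ^ d := by rw [← mul_pow, ← mul_pow]; exact h2
        _ ≤ (d + 1) ^ d * (n.choose d * d ^ d) := Nat.mul_le_mul_left _ h3
        _ = _ := by ring
    have h5 : (n + 1) ^ d ≤ (d + 1) ^ d * n.choose d :=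
      Nat.le_of_mul_le_mul_right h4 (by positivity)
    calc (n + 1) ^ (d + 1) = (n + 1) * (n + 1) ^ d := by ring
      _ ≤ (n + 1) * ((d + 1) ^ d * n.choose d) := Nat.mul_le_mul_left _ h5
      _ = (d + 1) ^ d * ((n + 1) * n.choose d) := by ring
      _ = (n + 1).choose (d + 1) * (d + 1) ^ (d + 1) := by rw [h1]; ring

theorem one_le_choose_mul_div_pow {n d w : ℕ} (h : d ≤ n) (hw : d ≤ w) (hn : 0 < n) :
    1 ≤ (n.choose d : ℝ) * ((w : ℝ) / n) ^ d := by
  have h1 : (n : ℝ) ^ d ≤ n.choose d * (d : ℝ) ^ d := by exact_mod_cast pow_le_choose_mul_pow h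
  have h2 : (d : ℝ) ^ d ≤ (w : ℝ) ^ d := by gcongr
  rw [div_pow, ← mul_div_assoc, one_le_div (by positivity)]
  exact h1.trans (by gcongr)

/-! ### The forest of undoped nodes of degree two -/

/-- In a finite forest there is no nonempty set of vertices each of which has two neighbours in the
set. -/
theorem _root_.SimpleGraph.IsAcyclic.not_forall_two_neighbors {V : Type*} [Finite V]
    {G : SimpleGraph V} (hG : G.IsAcyclic) {A : Set V} (hA : A.Nonempty)
    (h : ∀ v ∈ A, ∃ a ∈ A, ∃ b ∈ A, a ≠ b ∧ G.Adj v a ∧ G.Adj v b) : False := by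
  have : Nonempty A := hA.to_subtype
  -- At the end of a longest path inside `A`, a neighbour off the path would extend it, and one on
  -- the path other than the penultimate vertex would close a cycle.
  obtain ⟨u, v, p, hp, hmax⟩ :=
    SimpleGraph.Walk.exists_isPath_forall_isPath_length_le_length (G.induce A)
  have hpen : ∀ w, (G.induce A).Adj v w → w = p.penultimate := by
    intro w hw
    by_cases hs : w ∈ p.support
    · exact (hG.induce A).eq_penultimate_of_adj_end hp hw hs
    · have := hmax _ _ _ (hp.concat hs hw)
      simp at this
  obtain ⟨a, ha, b, hb, hab, hva, hvb⟩ := h v v.2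
  have e1 := hpen ⟨a, ha⟩ hva
  have e2 := hpen ⟨b, hb⟩ hvb
  exact hab (congrArg Subtype.val (e1.trans e2.symm))

/-- The inequalities that the check nodes impose on the weights `d` that a codeword has on the
copies of the variable nodes: an edge into an undoped node of degree two carries at most the total
weight of the other edges at its check node. -/
def IsBalanced {nc nv : ℕ} (B : Matrix (Fin nc) (Fin nv) ℕ) (D : Finset (Fin nv))
    (d : Fin nv → ℝ) : Prop :=
  ∀ i j, IsUndopedDegTwo B D j → B i j ≠ 0 → d j ≤ ∑ j' ∈ Finset.univ.erase j, B i j' * d j'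

-- Otherwise the nodes of nonzero weight and their checks would contradict acyclicity. Such a node
-- has two distinct checks because its two edges are not parallel. At such a check the balance
-- inequality supplies a second node of nonzero weight.
open Classical in
theorem IsBalanced.eq_zero {nc nv : ℕ} {B : Matrix (Fin nc) (Fin nv) ℕ} {D : Finset (Fin nv)}
    (hcycle : NoUndopedDegTwoCycle B D) {d : Fin nv → ℝ} (hd : 0 ≤ d) (hb : IsBalanced B D d)
    (hz : ∀ j, ¬ IsUndopedDegTwo B D j → d j = 0) : d = 0 := by
  obtain ⟨hpar, hac⟩ := hcycle
  by_contra hne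
  obtain ⟨j₀, hj₀⟩ := Function.ne_iff.1 hne
  have hU : ∀ j, d j ≠ 0 → IsUndopedDegTwo B D j := fun j hj => by
    by_contra h; exact hj (hz j h)
  let A : Set (Fin nv ⊕ Fin nc) :=
    {x | (∃ j, x = Sum.inl j ∧ d j ≠ 0) ∨ ∃ i, x = Sum.inr i ∧ ∃ j, d j ≠ 0 ∧ B i j ≠ 0}
  have hadj : ∀ i j, d j ≠ 0 → B i j ≠ 0 →
      (undopedDegTwoGraph B D).Adj (Sum.inl j) (Sum.inr i) := by
    intro i j hj hij
    rw [undopedDegTwoGraph, SimpleGraph.fromRel_adj]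
    exact ⟨by simp, Or.inl ⟨j, i, rfl, rfl, hU j hj, hij⟩⟩
  refine hac.not_forall_two_neighbors (A := A) ⟨Sum.inl j₀, Or.inl ⟨j₀, rfl, hj₀⟩⟩ ?_
  rintro x (⟨j, rfl, hj⟩ | ⟨i, rfl, j, hj, hij⟩)
  · have h2 : ∑ i, B i j = 2 := (hU j hj).2
    have hcard : 2 ≤ (Finset.univ.filter fun i => B i j ≠ 0).card := by
      rw [← h2, ← Finset.sum_filter_ne_zero, Finset.card_eq_sum_ones]
      exact Finset.sum_le_sum fun i _ => hpar i j (hU j hj)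
    obtain ⟨a, ha, b, hb', hab⟩ := Finset.one_lt_card.1 hcard
    rw [Finset.mem_filter] at ha hb'
    exact ⟨Sum.inr a, Or.inr ⟨a, rfl, j, hj, ha.2⟩, Sum.inr b, Or.inr ⟨b, rfl, j, hj, hb'.2⟩,
      by simpa using hab, hadj _ _ hj ha.2, hadj _ _ hj hb'.2⟩
  · have h1 := hb i j (hU j hj) hij
    have h2 : 0 < d j := lt_of_le_of_ne (hd j) (Ne.symm hj)
    obtain ⟨j', hj', hne'⟩ := Finset.exists_ne_zero_of_sum_ne_zero (h2.trans_le h1).ne'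
    have hd' : d j' ≠ 0 := right_ne_zero_of_mul hne'
    have hB' : B i j' ≠ 0 := by exact_mod_cast left_ne_zero_of_mul hne'
    exact ⟨Sum.inl j, Or.inl ⟨j, rfl, hj⟩, Sum.inl j', Or.inl ⟨j', rfl, hd'⟩,
      by simpa using (Finset.ne_of_mem_erase hj').symm, (hadj _ _ hj hij).symm,
      (hadj _ _ hd' hB').symm⟩

open Classical in
/-- If the undoped variable nodes of degree two form no cycle, the remaining variable nodes carry a
positive fraction of the weight of every codeword. -/
theorem exists_sum_le_of_isBalanced {nc nv : ℕ} {B : Matrix (Fin nc) (Fin nv) ℕ}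
    {D : Finset (Fin nv)} (hcycle : NoUndopedDegTwoCycle B D) :
    ∃ ε : ℝ, 0 < ε ∧ ∀ d : Fin nv → ℝ, 0 ≤ d → IsBalanced B D d →
      ε * ∑ j, d j ≤ ∑ j with ¬ IsUndopedDegTwo B D j, d j := by
  -- By homogeneity it suffices to treat total weight 1. There the balanced vectors form a compact
  -- set, and the right-hand side is positive on it by `IsBalanced.eq_zero`.
  let K : Set (Fin nv → ℝ) := {d | 0 ≤ d ∧ ∑ j, d j = 1 ∧ IsBalanced B D d}
  have hclosed : IsClosed K := by
    refine IsClosed.and (isClosed_le continuous_const continuous_id) (IsClosed.and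
      (isClosed_eq (by fun_prop) continuous_const) ?_)
    simp only [IsBalanced, Set.ofPred_forall]
    exact isClosed_iInter fun i => isClosed_iInter fun j => isClosed_iInter fun _ =>
      isClosed_iInter fun _ => isClosed_le (by fun_prop) (by fun_prop)
  have hcompact : IsCompact K := by
    refine (isCompact_Icc (a := (0 : Fin nv → ℝ)) (b := 1)).of_isClosed_subset hclosed ?_
    rintro d ⟨h0, h1, -⟩
    refine ⟨h0, fun j => ?_⟩
    simp only [Pi.one_apply]
    rw [← h1]
    exact Finset.single_le_sum (fun i _ => h0 i) (Finset.mem_univ j)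
  obtain ⟨ε, hε, hle⟩ := hcompact.exists_forall_le'
    (f := fun d : Fin nv → ℝ => ∑ j with ¬ IsUndopedDegTwo B D j, d j) (a := 0)
    (by fun_prop) (by
      rintro d ⟨h0, h1, hb⟩
      refine lt_of_le_of_ne (Finset.sum_nonneg fun j _ => h0 j) fun heq => ?_
      have hz := (Finset.sum_eq_zero_iff_of_nonneg fun j _ => h0 j).1 heq.symm
      have := hb.eq_zero hcycle h0 fun j hj => hz j (by simpa using hj)
      simp [this] at h1)
  refine ⟨ε, hε, fun d h0 hb => ?_⟩
  obtain hs | hs := (Finset.sum_nonneg fun j (_ : j ∈ Finset.univ) => h0 j).eq_or_lt'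
  · have hs : ∑ j, d j = 0 := hs
    rw [hs, mul_zero]
    exact Finset.sum_nonneg fun j _ => h0 j
  set s := ∑ j, d j with hsdef
  have hmem : (fun j => s⁻¹ * d j) ∈ K := by
    refine ⟨fun j => mul_nonneg (by positivity) (h0 j), ?_, fun i j hj hij => ?_⟩
    · rw [← Finset.mul_sum, inv_mul_cancel₀ hs.ne']
    · calc s⁻¹ * d j ≤ s⁻¹ * ∑ j' ∈ Finset.univ.erase j, B i j' * d j' := by
            gcongr; exact hb i j hj hij
        _ = _ := by
            rw [Finset.mul_sum]
            exact Finset.sum_congr rfl fun _ _ => by ring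
  have := hle _ hmem
  simp only [← Finset.mul_sum] at this
  rwa [inv_mul_eq_div, le_div_iff₀ hs] at this

/-! ### Parity checks under a random lifting -/

variable {nc nv : ℕ} {B : Matrix (Fin nc) (Fin nv) ℕ} {D : Finset (Fin nv)} {μ β : ℕ}
  {C : Submodule (ZMod 2) (Fin μ → ZMod 2)}

noncomputable instance : Fintype (Edge B) :=
  @Sigma.instFintype _ _ (fun i => @Sigma.instFintype _ _ (fun j => Fin.fintype (B i j)) _) _

noncomputable instance : DecidableEq (Edge B) := Classical.decEq _

/-- The copies of the variable node `j` that carry the symbol `1` in the word `c`. -/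
def nodeSupport (c : Fin nv × Copy μ β → ZMod 2) (j : Fin nv) : Finset (Copy μ β) :=
  Finset.univ.filter fun s => c (j, s) ≠ 0

/-- The word `c` satisfies the parity checks at all copies of all check nodes. -/
def SatisfiesChecks (c : Fin nv × Copy μ β → ZMod 2) (π : Lifting B μ β) : Prop :=
  ∀ (i : Fin nc) (s : Copy μ β), ∑ j : Fin nv, ∑ k : Fin (B i j), c (j, (π ⟨i, j, k⟩).symm s) = 0

theorem mem_map_nodeSupport {c : Fin nv × Copy μ β → ZMod 2} {j : Fin nv}
    {σ : Equiv.Perm (Copy μ β)} {s : Copy μ β} :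
    s ∈ (nodeSupport c j).map σ.toEmbedding ↔ c (j, σ.symm s) ≠ 0 := by
  simp [nodeSupport, Finset.mem_map_equiv]

theorem SatisfiesChecks.exists_other_edge {c : Fin nv × Copy μ β → ZMod 2} {π : Lifting B μ β}
    (h : SatisfiesChecks c π) {i : Fin nc} {p : Σ j : Fin nv, Fin (B i j)} {s : Copy μ β}
    (hp : c (p.1, (π ⟨i, p⟩).symm s) ≠ 0) :
    ∃ p' : Σ j : Fin nv, Fin (B i j), p' ≠ p ∧ c (p'.1, (π ⟨i, p'⟩).symm s) ≠ 0 := by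
  by_contra! hcon
  apply hp
  rw [← h i s, ← Fintype.sum_sigma' fun (j : Fin nv) (k : Fin (B i j)) =>
    c (j, (π ⟨i, j, k⟩).symm s)]
  exact (Fintype.sum_eq_single p hcon).symm

/-- Every 1 that `j` sends to a copy of `i` meets a 1 on another edge there. As `j` has a single
edge to `i`, that edge leads to a different node, and a union bound gives the inequality. -/
theorem SatisfiesChecks.isBalanced {c : Fin nv × Copy μ β → ZMod 2} {π : Lifting B μ β}
    (h : SatisfiesChecks c π) (hpar : ∀ i j, IsUndopedDegTwo B D j → B i j ≤ 1) :
    IsBalanced B D fun j => ((nodeSupport c j).card : ℝ) := by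
  intro i j hj hij
  have hB : B i j = 1 := le_antisymm (hpar i j hj) (Nat.one_le_iff_ne_zero.2 hij)
  have hsub : (nodeSupport c j).map (π ⟨i, j, ⟨0, by omega⟩⟩).toEmbedding ⊆
      (Finset.univ.erase j).biUnion fun j' => (Finset.univ : Finset (Fin (B i j'))).biUnion
        fun k => (nodeSupport c j').map (π ⟨i, j', k⟩).toEmbedding := by
    intro s hs
    obtain ⟨⟨j', k⟩, hne, hc⟩ :=
      h.exists_other_edge (p := ⟨j, ⟨0, by omega⟩⟩) (mem_map_nodeSupport.1 hs)
    simp only [Finset.mem_biUnion, Finset.mem_erase, Finset.mem_univ, and_true, true_and]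
    refine ⟨j', ?_, k, mem_map_nodeSupport.2 hc⟩
    rintro rfl
    exact hne (by congr 1; ext; have := k.2; simp; omega)
  have hcard : (nodeSupport c j).card ≤ ∑ j' ∈ Finset.univ.erase j,
      B i j' * (nodeSupport c j').card := by
    rw [← Finset.card_map]
    refine (Finset.card_le_card hsub).trans (Finset.card_biUnion_le.trans ?_)
    refine Finset.sum_le_sum fun j' _ => Finset.card_biUnion_le.trans ?_
    simp
  beta_reduce
  exact_mod_cast hcard

open Classical in
/-- The edges at the check node copy `x` whose other end carries the symbol `1`. -/
noncomputable def activeEdges (c : Fin nv × Copy μ β → ZMod 2) (π : Lifting B μ β)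
    (x : Fin nc × Copy μ β) : Finset (Edge B) :=
  Finset.univ.filter fun e => e.1 = x.1 ∧ x.2 ∈ (nodeSupport c e.2.1).map (π e).toEmbedding

-- Double counting of pairs (check copy, active edge): a nonempty pattern has at least two edges,
-- while an edge is active at as many check copies as its variable node has 1s.
open Classical in
theorem SatisfiesChecks.two_mul_card_activeEdges_ne_empty_le {c : Fin nv × Copy μ β → ZMod 2}
    {π : Lifting B μ β} (h : SatisfiesChecks c π) :
    2 * (Finset.univ.filter fun x => activeEdges c π x ≠ ∅).card
      ≤ ∑ e : Edge B, (nodeSupport c e.2.1).card := by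
  have h1 : ∀ x, activeEdges c π x ≠ ∅ → 2 ≤ (activeEdges c π x).card := by
    rintro ⟨i, s⟩ hx
    obtain ⟨⟨i', p⟩, he⟩ := Finset.nonempty_iff_ne_empty.2 hx
    simp only [activeEdges, Finset.mem_filter, Finset.mem_univ, true_and] at he
    obtain ⟨rfl, hs⟩ := he
    obtain ⟨p', hne, hp'⟩ := h.exists_other_edge (mem_map_nodeSupport.1 hs)
    refine Finset.one_lt_card.2 ⟨⟨i', p⟩, ?_, ⟨i', p'⟩, ?_, ?_⟩
    · simpa [activeEdges] using hs
    · simpa [activeEdges] using mem_map_nodeSupport.2 hp'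
    · intro heq
      exact hne (eq_of_heq (Sigma.mk.inj heq).2).symm
  have h2 : ∑ x, (activeEdges c π x).card = ∑ e : Edge B, (nodeSupport c e.2.1).card := by
    simp only [activeEdges, Finset.card_filter]
    rw [Finset.sum_comm]
    refine Finset.sum_congr rfl fun e _ => ?_
    rw [Fintype.sum_prod_type, Finset.sum_eq_single e.1]
    · rw [← Finset.card_map (π e).toEmbedding, ← Finset.card_filter]
      congr 1
      ext s; simp
    · intro i _ hi
      simp [hi.symm]
    · simp
  rw [← h2, mul_comm, ← smul_eq_mul, ← Finset.sum_const]
  calc _ ≤ ∑ x with activeEdges c π x ≠ ∅, (activeEdges c π x).card :=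
        Finset.sum_le_sum fun x hx => h1 x (Finset.mem_filter.1 hx).2
    _ ≤ _ := Finset.sum_le_sum_of_subset (Finset.filter_subset _ _)

theorem card_lifting : Fintype.card (Lifting B μ β) = ∏ _e : Edge B, (β * μ).factorial := by
  rw [Fintype.card_pi]
  simp [Fintype.card_perm]

open Classical in
/-- The number of liftings for which a given word satisfies all checks. -/
theorem card_satisfiesChecks_mul_le (c : Fin nv × Copy μ β → ZMod 2) :
    Fintype.card {π : Lifting B μ β // SatisfiesChecks c π}
        * ∏ e : Edge B, (β * μ).choose (nodeSupport c e.2.1).card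
      ≤ Fintype.card {g : Fin nc × Copy μ β → Finset (Edge B) //
          2 * (Finset.univ.filter fun x => g x ≠ ∅).card
            ≤ ∑ e : Edge B, (nodeSupport c e.2.1).card}
        * Fintype.card (Lifting B μ β) := by
  have hfib : ∀ g : Fin nc × Copy μ β → Finset (Edge B),
      (Finset.univ.filter fun π : Lifting B μ β => activeEdges c π = g).card
        * ∏ e : Edge B, (β * μ).choose (nodeSupport c e.2.1).card
        ≤ Fintype.card (Lifting B μ β) := by
    intro g
    -- Fixing the pattern prescribes, for each edge separately, the image of the support under its
    -- permutation.
    have hle : (Finset.univ.filter fun π : Lifting B μ β => activeEdges c π = g).card ≤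
        ∏ e : Edge B, Fintype.card {σ : Equiv.Perm (Copy μ β) //
          (nodeSupport c e.2.1).map σ.toEmbedding
            = Finset.univ.filter fun s => e ∈ g (e.1, s)} := by
      rw [← Fintype.card_pi, ← Fintype.card_subtype]
      refine Fintype.card_le_of_injective (fun π e => ⟨π.1 e, ?_⟩) fun π π' hππ' => ?_
      · ext s
        have := Finset.ext_iff.1 (congrFun π.2 (e.1, s)) e
        simpa [activeEdges] using this
      · ext1; funext e
        exact congrArg Subtype.val (congrFun hππ' e)
    refine (Nat.mul_le_mul_right _ hle).trans ?_
    rw [← Finset.prod_mul_distrib, card_lifting]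
    refine Finset.prod_le_prod' fun e _ => ?_
    simpa using card_perm_map_eq_mul_choose_le (nodeSupport c e.2.1)
      (Finset.univ.filter fun s => e ∈ g (e.1, s))
  rw [Fintype.card_subtype, Fintype.card_subtype]
  rw [Finset.card_eq_sum_card_fiberwise (f := fun π => activeEdges c π)
    (t := Finset.univ.filter fun g : Fin nc × Copy μ β → Finset (Edge B) =>
      2 * (Finset.univ.filter fun x => g x ≠ ∅).card ≤ ∑ e : Edge B, (nodeSupport c e.2.1).card)
    (by
      intro π hπ
      simp only [Finset.coe_filter, Finset.mem_univ, true_and, Set.mem_ofPred_eq] at hπ ⊢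
      exact hπ.two_mul_card_activeEdges_ne_empty_le), Finset.sum_mul]
  refine Finset.sum_le_card_nsmul _ _ _ fun g _ => le_trans (Nat.mul_le_mul_right _ ?_) (hfib g)
  exact Finset.card_le_card (Finset.filter_subset_filter _ (Finset.subset_univ _))

/-! ### Counting the words on one variable node -/

/-- A codeword is a vanishing sum of columns of `H`; one column is nonzero, and two distinct columns
cannot cancel. -/
theorem IsHammingCode.three_le_card_ne_zero {κ : ℕ} (hC : IsHammingCode κ C) {w : Fin μ → ZMod 2}
    (hw : w ∈ C) (hw0 : w ≠ 0) : 3 ≤ (Finset.univ.filter fun t => w t ≠ 0).card := by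
  obtain ⟨r, -, -, H, ⟨hinj, hrange⟩, hmem⟩ := hC
  have hsum : ∑ t with w t ≠ 0, H.col t = 0 := by
    rw [← (hmem w).1 hw, Finset.sum_filter]
    funext a
    simp only [Matrix.mulVec, dotProduct, Finset.sum_apply]
    refine Finset.sum_congr rfl fun t _ => ?_
    have : ∀ z : ZMod 2, z = 0 ∨ z = 1 := by decide
    rcases this (w t) with h | h <;> simp [h]
  have hne : ∀ t, H.col t ≠ 0 := fun t => by
    have : H.col t ∈ Set.range H.col := ⟨t, rfl⟩
    rw [hrange] at this; exact this
  by_contra! hlt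
  have hpos : 0 < (Finset.univ.filter fun t => w t ≠ 0).card := by
    obtain ⟨t, ht⟩ := Function.ne_iff.1 hw0
    exact Finset.card_pos.2 ⟨t, by simpa using ht⟩
  obtain h1 | h2 : (Finset.univ.filter fun t => w t ≠ 0).card = 1 ∨
    (Finset.univ.filter fun t => w t ≠ 0).card = 2 := by omega
  · obtain ⟨t, ht⟩ := Finset.card_eq_one.1 h1
    rw [ht, Finset.sum_singleton] at hsum
    exact hne t hsum
  · obtain ⟨t, t', htt', ht⟩ := Finset.card_eq_two.1 h2
    rw [ht, Finset.sum_pair htt'] at hsum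
    apply htt'
    apply hinj
    have : ∀ x y : ZMod 2, x + y = 0 → x = y := by decide
    funext a
    exact this _ _ (congrFun hsum a)

open Classical in
/-- The number of words of weight `d` on the copies of one variable node is at most a binomial
coefficient. -/
theorem card_nodeWords_le_choose (d : ℕ) (P : (Copy μ β → ZMod 2) → Prop) :
    Fintype.card {f : Copy μ β → ZMod 2 // (Finset.univ.filter fun s => f s ≠ 0).card = d ∧ P f}
      ≤ (β * μ).choose d := by
  have : (Finset.powersetCard d (Finset.univ : Finset (Copy μ β))).card = (β * μ).choose d := by
    simp
  rw [← this, Fintype.card_subtype]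
  refine Finset.card_le_card_of_injOn (fun f => Finset.univ.filter fun s => f s ≠ 0) ?_ ?_
  · intro f hf
    simp only [Finset.coe_filter, Finset.mem_univ, true_and, Set.mem_ofPred_eq] at hf
    simp [Finset.mem_powersetCard, hf.1]
  · intro f _ f' _ hff'
    funext s
    have h1 : f s ≠ 0 ↔ f' s ≠ 0 := by simpa using Finset.ext_iff.1 hff' s
    have : ∀ x y : ZMod 2, (x ≠ 0 ↔ y ≠ 0) → x = y := by decide
    exact this _ _ h1

open Classical in
/-- The number of words of weight `d` on the copies of a doped variable node is at most the number
of words with at most `d / 3` nonzero blocks. -/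
theorem card_dopedWords_le {κ : ℕ} (hC : IsHammingCode κ C) (d : ℕ) :
    Fintype.card {f : Copy μ β → ZMod 2 // (Finset.univ.filter fun s => f s ≠ 0).card = d ∧
        ∀ b, (fun t => f (b, t)) ∈ C}
      ≤ Fintype.card {g : Fin β → (Fin μ → ZMod 2) //
          3 * (Finset.univ.filter fun b => g b ≠ 0).card ≤ d} := by
  have key : ∀ f : Copy μ β → ZMod 2, (∀ b, (fun t => f (b, t)) ∈ C) →
      3 * (Finset.univ.filter fun b => (fun t => f (b, t)) ≠ 0).card
        ≤ (Finset.univ.filter fun s => f s ≠ 0).card := by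
    intro f hfC
    rw [Finset.card_filter (fun s => f s ≠ 0), Fintype.sum_prod_type, mul_comm,
      ← smul_eq_mul, ← Finset.sum_const]
    calc _ ≤ ∑ b with (fun t => f (b, t)) ≠ 0, ∑ t, (if f (b, t) ≠ 0 then 1 else 0) := by
          refine Finset.sum_le_sum fun b hb => ?_
          rw [← Finset.card_filter]
          exact hC.three_le_card_ne_zero (hfC b) (Finset.mem_filter.1 hb).2
      _ ≤ _ := Finset.sum_le_sum_of_subset (Finset.filter_subset _ _)
  refine Fintype.card_le_of_injective
    (fun f => ⟨fun b t => f.1 (b, t), (key f.1 f.2.2).trans f.2.1.le⟩) fun f f' hff' => ?_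
  ext1; funext ⟨b, t⟩
  exact congrFun (congrFun (congrArg Subtype.val hff') b) t

open Classical in
/-- The number of words of weight `d` that the component code allows on the copies of the variable
node `j`. -/
noncomputable def nodeWordCount (D : Finset (Fin nv)) (C : Submodule (ZMod 2) (Fin μ → ZMod 2))
    (β : ℕ) (j : Fin nv) (d : ℕ) : ℕ :=
  Fintype.card {f : Copy μ β → ZMod 2 // (Finset.univ.filter fun s => f s ≠ 0).card = d ∧
    (j ∈ D → ∀ b, (fun t => f (b, t)) ∈ C)}

/-! ### The first moment for prescribed weights -/

open Classical in
/-- The codewords of all liftings with prescribed weights on the variable nodes. -/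
theorem card_exists_codeword_mul_le (d : Fin nv → ℕ) :
    Fintype.card {π : Lifting B μ β // ∃ c ∈ code D C π, ∀ j, (nodeSupport c j).card = d j}
        * ∏ e : Edge B, (β * μ).choose (d e.2.1)
      ≤ (∏ j, nodeWordCount D C β j (d j))
        * (Fintype.card {g : Fin nc × Copy μ β → Finset (Edge B) //
            2 * (Finset.univ.filter fun x => g x ≠ ∅).card ≤ ∑ e : Edge B, d e.2.1}
          * Fintype.card (Lifting B μ β)) := by
  set words : Finset (Fin nv × Copy μ β → ZMod 2) := Finset.univ.filter fun c =>
    ∀ j, (nodeSupport c j).card = d j ∧ (j ∈ D → ∀ b, (fun t => c (j, (b, t))) ∈ C) with hwords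
  have hcount : words.card ≤ ∏ j, nodeWordCount D C β j (d j) := by
    simp only [nodeWordCount]
    rw [← Fintype.card_pi, hwords, ← Fintype.card_subtype]
    refine Fintype.card_le_of_injective (fun c j => ⟨fun s => c.1 (j, s), c.2 j⟩)
      fun c c' hcc' => ?_
    ext1; funext ⟨j, s⟩
    exact congrFun (congrArg Subtype.val (congrFun hcc' j)) s
  have hunion : Fintype.card
      {π : Lifting B μ β // ∃ c ∈ code D C π, ∀ j, (nodeSupport c j).card = d j}
      ≤ ∑ c ∈ words, Fintype.card {π : Lifting B μ β // SatisfiesChecks c π} := by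
    simp only [Fintype.card_subtype]
    refine le_trans (Finset.card_le_card ?_) Finset.card_biUnion_le
    intro π hπ
    obtain ⟨c, hc, hcd⟩ := (Finset.mem_filter.1 hπ).2
    refine Finset.mem_biUnion.2 ⟨c, ?_, Finset.mem_filter.2 ⟨Finset.mem_univ _, hc.1⟩⟩
    exact Finset.mem_filter.2 ⟨Finset.mem_univ _, fun j => ⟨hcd j, hc.2 j⟩⟩
  refine (Nat.mul_le_mul_right _ hunion).trans (le_trans ?_ (Nat.mul_le_mul_right _ hcount))
  rw [Finset.sum_mul]
  refine Finset.sum_le_card_nsmul _ _ _ fun c hc => ?_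
  have h := card_satisfiesChecks_mul_le (B := B) c
  simp only [fun j => ((Finset.mem_filter.1 hc).2 j).1] at h
  exact h

theorem prod_edge_eq {M : Type*} [CommMonoid M] (f : Fin nv → M) :
    ∏ e : Edge B, f e.2.1 = ∏ j, f j ^ varDegree B j := by
  let _ : ∀ i, Fintype (Σ j, Fin (B i j)) := fun i => inferInstance
  refine (Fintype.prod_sigma fun e : Edge B => f e.2.1).trans ?_
  simp only [Fintype.prod_sigma, Finset.prod_const, Finset.card_univ, Fintype.card_fin, varDegree,
    ← Finset.prod_pow_eq_pow_sum]
  exact Finset.prod_comm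

theorem sum_edge_eq (f : Fin nv → ℕ) :
    ∑ e : Edge B, f e.2.1 = ∑ j, varDegree B j * f j := by
  let _ : ∀ i, Fintype (Σ j, Fin (B i j)) := fun i => inferInstance
  refine (Fintype.sum_sigma fun e : Edge B => f e.2.1).trans ?_
  simp only [Fintype.sum_sigma, Finset.sum_const, Finset.card_univ, Fintype.card_fin, varDegree,
    Finset.sum_mul, smul_eq_mul]
  exact Finset.sum_comm

open Classical in
/-- The gain exponent per unit of weight at the variable node `j`. -/
noncomputable def gain (B : Matrix (Fin nc) (Fin nv) ℕ) (D : Finset (Fin nv)) (j : Fin nv) : ℝ :=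
  if IsUndopedDegTwo B D j then 0 else 1 / 6

/-- The power of the binomial cancels against the edge probabilities, and the exponent `varDegree B
j / 2` pays for the choice of patterns; `gain` is what remains. With degree `q`, an undoped node
leaves `(q - 1) - q / 2`, which is 0 for `q = 2` and at least `1 / 2` beyond. A doped node leaves `q
/ 2 - 1 / 3`, which equals `1 / 6` in the worst case `q = 1`. -/
theorem nodeWordCount_le {κ : ℕ} (hC : IsHammingCode κ C)
    (hundoped : ∀ j, j ∉ D → 2 ≤ varDegree B j) (hdoped : ∀ j ∈ D, 1 ≤ varDegree B j)
    (j : Fin nv) {d w : ℕ} (hdw : d ≤ w) (hw0 : 0 < w) (hw : w ≤ β * μ) :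
    (nodeWordCount D C β j d : ℝ) ≤ Real.exp (Fintype.card (Fin μ → ZMod 2) * w)
      * (((β * μ).choose d : ℝ) ^ varDegree B j
        * ((w : ℝ) / (β * μ : ℕ)) ^ (((varDegree B j : ℝ) / 2 + gain B D j) * d)) := by
  classical
  have hN : 0 < β * μ := hw0.trans_le hw
  have hμ : 0 < μ := Nat.pos_of_mul_pos_left hN
  set t : ℝ := (w : ℝ) / (β * μ : ℕ) with ht
  set X : ℝ := ((β * μ).choose d : ℝ) with hX
  set q := varDegree B j with hq
  have ht0 : 0 < t := by positivity
  have ht1 : t ≤ 1 := (div_le_one (by positivity)).2 (by exact_mod_cast hw)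
  have hX1 : 1 ≤ X * t ^ d := one_le_choose_mul_div_pow (hdw.trans hw) hdw hN
  have hd0 : (0 : ℝ) ≤ d := Nat.cast_nonneg d
  by_cases hj : j ∈ D
  · have hq1 : (1 : ℝ) ≤ q := by exact_mod_cast hdoped j hj
    have hgain : gain B D j = 1 / 6 := by
      simp [gain, IsUndopedDegTwo, hj]
    have h1 : (nodeWordCount D C β j d : ℝ) * t ^ ((d : ℝ) / 3)
        ≤ Real.exp (Fintype.card (Fin μ → ZMod 2) * w) := by
      have h2 := card_sparse_mul_rpow_le (X := Fin β) (0 : Fin μ → ZMod 2) (k := 3) (by norm_num) d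
        ht0 ht1
      have h3 : nodeWordCount D C β j d ≤ _ :=
        (Fintype.card_subtype_mono _ _ fun f hf => ⟨hf.1, hf.2 hj⟩).trans (card_dopedWords_le hC d)
      refine le_trans ?_ (h2.trans ?_)
      · push_cast
        gcongr
      · rw [Real.exp_le_exp, mul_assoc]
        refine mul_le_mul_of_nonneg_left ?_ (Nat.cast_nonneg _)
        rw [Fintype.card_fin, ht, ← mul_div_assoc, div_le_iff₀ (by positivity)]
        have : (1 : ℝ) ≤ μ := by exact_mod_cast hμ
        push_cast
        nlinarith [mul_nonneg (mul_nonneg (Nat.cast_nonneg (α := ℝ) β)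
          (Nat.cast_nonneg (α := ℝ) w)) (sub_nonneg.2 this)]
    calc (nodeWordCount D C β j d : ℝ)
        = nodeWordCount D C β j d * t ^ ((d : ℝ) / 3) * t ^ (-((d : ℝ) / 3)) := by
          rw [mul_assoc, ← Real.rpow_add ht0]; simp
      _ ≤ Real.exp (Fintype.card (Fin μ → ZMod 2) * w) * t ^ (-((d : ℝ) / 3)) := by gcongr
      _ ≤ Real.exp (Fintype.card (Fin μ → ZMod 2) * w)
            * (t ^ (-((d : ℝ) / 3)) * (X * t ^ d) ^ q) := by
          gcongr
          exact le_mul_of_one_le_right (by positivity) (one_le_pow₀ hX1)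
      _ = Real.exp (Fintype.card (Fin μ → ZMod 2) * w)
            * (X ^ q * t ^ (-((d : ℝ) / 3) + d * q)) := by
          rw [Real.rpow_add ht0, mul_pow, ← pow_mul, ← Real.rpow_natCast t (d * q)]
          push_cast
          ring
      _ ≤ _ := by
          gcongr _ * (_ * ?_)
          refine Real.rpow_le_rpow_of_exponent_ge ht0 ht1 ?_
          rw [hgain]
          nlinarith
  · have hq2 : 2 ≤ q := hundoped j hj
    have h1 : (nodeWordCount D C β j d : ℝ) ≤ X := by
      rw [hX, Nat.cast_le]
      unfold nodeWordCount
      convert card_nodeWords_le_choose (μ := μ) (β := β) d fun f => j ∈ D → ∀ b, (fun t => f (b, t)) ∈ C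
    have hX0 : 0 ≤ X := hX ▸ Nat.cast_nonneg _
    clear_value X t
    calc (nodeWordCount D C β j d : ℝ) ≤ X := h1
      _ ≤ X * (X * t ^ d) ^ (q - 1) := le_mul_of_one_le_right (by positivity) (one_le_pow₀ hX1)
      _ = X ^ q * t ^ ((d * (q - 1 : ℕ) : ℕ) : ℝ) := by
          rw [mul_pow, ← pow_mul, Real.rpow_natCast, ← mul_assoc, mul_pow_sub_one (by omega)]
      _ ≤ X ^ q * t ^ (((q : ℝ) / 2 + gain B D j) * d) := by
          gcongr _ * ?_
          refine Real.rpow_le_rpow_of_exponent_ge ht0 ht1 ?_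
          push_cast [Nat.cast_sub (show 1 ≤ q by omega)]
          have hg : (q : ℝ) / 2 + gain B D j ≤ q - 1 := by
            unfold gain
            split_ifs with hU
            · have : (q : ℝ) = 2 := by exact_mod_cast hU.2
              rw [this]; norm_num
            · have : 3 ≤ q := by
                have : q ≠ 2 := fun h => hU ⟨hj, h⟩
                omega
              have : (3 : ℝ) ≤ q := by exact_mod_cast this
              linarith
          rw [mul_comm (d : ℝ)]
          exact mul_le_mul_of_nonneg_right hg hd0
      _ ≤ _ := le_mul_of_one_le_left (by positivity) (Real.one_le_exp (by positivity))

open Classical in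
/-- The probability that some codeword has prescribed weights on the variable nodes. -/
theorem card_exists_codeword_le {κ : ℕ} (hC : IsHammingCode κ C)
    (hundoped : ∀ j, j ∉ D → 2 ≤ varDegree B j) (hdoped : ∀ j ∈ D, 1 ≤ varDegree B j)
    {d : Fin nv → ℕ} {w : ℕ} (hdw : ∑ j, d j = w) (hw0 : 0 < w) (hw : w ≤ β * μ) :
    (Fintype.card {π : Lifting B μ β // ∃ c ∈ code D C π, ∀ j, (nodeSupport c j).card = d j} : ℝ)
      ≤ Real.exp ((nv * Fintype.card (Fin μ → ZMod 2) + nc * Fintype.card (Finset (Edge B))) * w)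
        * ((w : ℝ) / (β * μ : ℕ)) ^ (∑ j, gain B D j * d j) * Fintype.card (Lifting B μ β) := by
  have hN : 0 < β * μ := hw0.trans_le hw
  have hdj : ∀ j, d j ≤ w := fun j => by
    rw [← hdw]; exact Finset.single_le_sum (fun _ _ => Nat.zero_le _) (Finset.mem_univ j)
  have hmain := card_exists_codeword_mul_le (B := B) (D := D) (C := C) (β := β) d
  set t : ℝ := (w : ℝ) / (β * μ : ℕ) with ht
  have ht0 : 0 < t := by positivity
  have ht1 : t ≤ 1 := (div_le_one (by positivity)).2 (by exact_mod_cast hw)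
  have hsparse := card_sparse_mul_rpow_le (X := Fin nc × Copy μ β) (∅ : Finset (Edge B)) (k := 2)
    (by norm_num) (∑ e : Edge B, d e.2.1) ht0 ht1
  rw [prod_edge_eq fun j => (β * μ).choose (d j)] at hmain
  set S := Fintype.card {g : Fin nc × Copy μ β → Finset (Edge B) //
            2 * (Finset.univ.filter fun x => g x ≠ ∅).card ≤ ∑ e : Edge B, d e.2.1}
  have hmain' := (Nat.cast_le (α := ℝ)).2 hmain
  push_cast at hmain'
  set Q : ℝ := ∏ j, ((β * μ).choose (d j) : ℝ) ^ varDegree B j with hQ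
  have hQ0 : 0 < Q := Finset.prod_pos fun j _ => by
    have := Nat.choose_pos ((hdj j).trans hw)
    positivity
  have hwords : ∏ j, (nodeWordCount D C β j (d j) : ℝ)
      ≤ Real.exp (nv * Fintype.card (Fin μ → ZMod 2) * w)
        * (Q * (t ^ (((∑ e : Edge B, d e.2.1 : ℕ) : ℝ) / (2 : ℕ))
          * t ^ (∑ j, gain B D j * d j))) := by
    refine (Finset.prod_le_prod (fun _ _ => Nat.cast_nonneg _) fun j _ =>
      nodeWordCount_le hC hundoped hdoped j (hdj j) hw0 hw).trans_eq ?_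
    rw [Finset.prod_mul_distrib, Finset.prod_mul_distrib, Finset.prod_const, Finset.card_univ,
      Fintype.card_fin, ← Real.exp_nat_mul, ← Real.rpow_sum_of_pos ht0, ← Real.rpow_add ht0,
      mul_assoc (nv : ℝ)]
    congr 4
    rw [sum_edge_eq]
    push_cast
    rw [Finset.sum_div, ← Finset.sum_add_distrib]
    exact Finset.sum_congr rfl fun j _ => by ring
  -- There are `nc * N` check copies, and `N * t = w`.
  have hS : S * t ^ (((∑ e : Edge B, d e.2.1 : ℕ) : ℝ) / (2 : ℕ))
      ≤ Real.exp (nc * Fintype.card (Finset (Edge B)) * w) := by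
    refine hsparse.trans_eq ?_
    congr 1
    rw [ht]
    simp only [Fintype.card_prod, Fintype.card_fin]
    push_cast
    have : (β : ℝ) * μ ≠ 0 := by exact_mod_cast hN.ne'
    rw [mul_div_assoc', div_eq_iff this]
    ring
  refine le_of_mul_le_mul_right (hmain'.trans ?_) hQ0
  calc _ ≤ Real.exp (nv * Fintype.card (Fin μ → ZMod 2) * w)
        * (Q * (t ^ (((∑ e : Edge B, d e.2.1 : ℕ) : ℝ) / (2 : ℕ))
          * t ^ (∑ j, gain B D j * d j))) * (S * Fintype.card (Lifting B μ β)) := by gcongr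
    _ = Real.exp (nv * Fintype.card (Fin μ → ZMod 2) * w)
        * (S * t ^ (((∑ e : Edge B, d e.2.1 : ℕ) : ℝ) / (2 : ℕ)))
        * t ^ (∑ j, gain B D j * d j) * Fintype.card (Lifting B μ β) * Q := by ring
    _ ≤ Real.exp (nv * Fintype.card (Fin μ → ZMod 2) * w)
        * Real.exp (nc * Fintype.card (Finset (Edge B)) * w)
        * t ^ (∑ j, gain B D j * d j) * Fintype.card (Lifting B μ β) * Q := by gcongr
    _ = _ := by rw [← Real.exp_add]; ring_nf

theorem sum_card_nodeSupport (c : Fin nv × Copy μ β → ZMod 2) :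
    ∑ j, (nodeSupport c j).card = hammingNorm c := by
  simp only [nodeSupport, hammingNorm, Finset.card_filter]
  rw [Fintype.sum_prod_type]

/-- Rounding `x` up to a natural number lets the lower bound on all weights pass to the infimum in
`ℕ∞`, including the value `⊤` of the zero code. -/
theorem exists_codeword_of_minDist_lt {ι : Type*} [Fintype ι] {E : Submodule (ZMod 2) (ι → ZMod 2)}
    {x : ℝ} (h : (minDist E : ℝ≥0∞) < ENNReal.ofReal x) :
    ∃ c ∈ E, c ≠ 0 ∧ (hammingNorm c : ℝ) < x := by
  by_contra! hcon
  have h1 : ((⌈x⌉₊ : ℕ) : ℕ∞) ≤ minDist E :=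
    le_iInf fun c => le_iInf fun hc => le_iInf fun h0 => by
      exact_mod_cast Nat.ceil_le.2 (hcon c hc h0)
  have h2 : ENNReal.ofReal x ≤ ((⌈x⌉₊ : ℕ) : ℝ≥0∞) := by
    rw [← ENNReal.ofReal_natCast]
    exact ENNReal.ofReal_le_ofReal (Nat.le_ceil x)
  have h3 : ((⌈x⌉₊ : ℕ) : ℝ≥0∞) ≤ (minDist E : ℝ≥0∞) := by
    have := ENat.toENNReal_le.2 h1
    simpa using this
  exact absurd h (not_lt.2 (h2.trans h3))

open Classical in
/-- If the undoped variable nodes of degree two form no cycle, the expected number of weight vectors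
of codewords of weight `w` decays like a power of `(w / N) ^ w`. -/
theorem exists_card_codeword_weight_le {κ : ℕ} (hC : IsHammingCode κ C)
    (hundoped : ∀ j, j ∉ D → 2 ≤ varDegree B j) (hdoped : ∀ j ∈ D, 1 ≤ varDegree B j)
    (hcycle : NoUndopedDegTwoCycle B D) :
    ∃ K a : ℝ, 1 ≤ K ∧ 0 < a ∧ ∀ β w : ℕ, 0 < w → w ≤ β * μ →
      (Fintype.card {π : Lifting B μ β // ∃ c ∈ code D C π, hammingNorm c = w} : ℝ)
        ≤ (K * ((w : ℝ) / (β * μ : ℕ)) ^ a) ^ w * Fintype.card (Lifting B μ β) := by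
  obtain ⟨ε, hε, hbal⟩ := exists_sum_le_of_isBalanced hcycle
  set L : ℝ := nv * Fintype.card (Fin μ → ZMod 2) + nc * Fintype.card (Finset (Edge B)) with hL
  have hL0 : 0 ≤ L := by positivity
  refine ⟨2 ^ nv * Real.exp L, ε / 6, one_le_mul_of_one_le_of_one_le (one_le_pow₀ (by norm_num))
    (Real.one_le_exp hL0), by positivity, fun β w hw0 hw => ?_⟩
  have hN : 0 < β * μ := hw0.trans_le hw
  set t : ℝ := (w : ℝ) / (β * μ : ℕ) with ht
  have ht0 : 0 < t := by positivity
  have ht1 : t ≤ 1 := (div_le_one (by positivity)).2 (by exact_mod_cast hw)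
  have hvec : ∀ d : Fin nv → ℕ, ∑ j, d j = w →
      (Fintype.card {π : Lifting B μ β // ∃ c ∈ code D C π, ∀ j, (nodeSupport c j).card = d j} : ℝ)
        ≤ Real.exp (L * w) * t ^ (ε / 6 * w) * Fintype.card (Lifting B μ β) := by
    intro d hd
    -- Either no lifting realises the weights `d` and the count is 0, or one codeword with these
    -- weights shows that `d` is balanced.
    obtain hemp | ⟨⟨π, c, hc, hcd⟩⟩ := isEmpty_or_nonempty
      {π : Lifting B μ β // ∃ c ∈ code D C π, ∀ j, (nodeSupport c j).card = d j}
    · rw [Fintype.card_eq_zero]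
      simp only [Nat.cast_zero]
      positivity
    refine (card_exists_codeword_le hC hundoped hdoped hd hw0 hw).trans ?_
    have hcb : IsBalanced B D fun j => ((nodeSupport c j).card : ℝ) :=
      SatisfiesChecks.isBalanced (π := π) hc.1 hcycle.1
    simp only [hcd] at hcb
    have h1 := hbal _ (fun j => Nat.cast_nonneg (d j)) hcb
    have h2 : ε / 6 * w ≤ ∑ j, gain B D j * d j := by
      have h3 : ∑ j, gain B D j * d j = 1 / 6 * ∑ j with ¬ IsUndopedDegTwo B D j, (d j : ℝ) := by
        rw [Finset.sum_filter, Finset.mul_sum]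
        refine Finset.sum_congr rfl fun j _ => ?_
        unfold gain
        split_ifs <;> simp_all
      rw [← Nat.cast_sum, hd] at h1
      rw [h3]
      linarith
    gcongr _ * ?_ * _
    exact Real.rpow_le_rpow_of_exponent_ge ht0 ht1 h2
  set V : Finset (Fin nv → ℕ) := (Fintype.piFinset fun _ => Finset.range (w + 1)).filter
    fun d => ∑ j, d j = w with hV
  -- The number of weight vectors is polynomial in `w`; a crude exponential bound can be absorbed
  -- into `K ^ w`.
  have hVcard : (V.card : ℝ) ≤ (2 ^ nv) ^ w := by
    have h1 : V.card ≤ (w + 1) ^ nv := by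
      refine (Finset.card_filter_le _ _).trans ?_
      simp
    have h2 : (w + 1) ^ nv ≤ (2 ^ w) ^ nv := Nat.pow_le_pow_left Nat.lt_two_pow_self nv
    rw [← pow_mul, mul_comm, pow_mul]
    exact_mod_cast h1.trans h2
  have hunion : Fintype.card {π : Lifting B μ β // ∃ c ∈ code D C π, hammingNorm c = w}
      ≤ ∑ d ∈ V, Fintype.card
        {π : Lifting B μ β // ∃ c ∈ code D C π, ∀ j, (nodeSupport c j).card = d j} := by
    simp only [Fintype.card_subtype]
    refine le_trans (Finset.card_le_card ?_) Finset.card_biUnion_le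
    intro π hπ
    obtain ⟨c, hc, hcw⟩ := (Finset.mem_filter.1 hπ).2
    rw [← sum_card_nodeSupport] at hcw
    refine Finset.mem_biUnion.2 ⟨fun j => (nodeSupport c j).card, ?_,
      Finset.mem_filter.2 ⟨Finset.mem_univ _, c, hc, fun j => rfl⟩⟩
    refine Finset.mem_filter.2 ⟨Fintype.mem_piFinset.2 fun j => ?_, hcw⟩
    rw [Finset.mem_range, Nat.lt_succ_iff, ← hcw]
    exact Finset.single_le_sum (f := fun j => (nodeSupport c j).card) (fun _ _ => Nat.zero_le _)
      (Finset.mem_univ j)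
  calc (Fintype.card {π : Lifting B μ β // ∃ c ∈ code D C π, hammingNorm c = w} : ℝ)
      ≤ ∑ d ∈ V, (Fintype.card
        {π : Lifting B μ β // ∃ c ∈ code D C π, ∀ j, (nodeSupport c j).card = d j} : ℝ) := by
        exact_mod_cast hunion
    _ ≤ V.card • (Real.exp (L * w) * t ^ (ε / 6 * w) * Fintype.card (Lifting B μ β)) :=
        Finset.sum_le_card_nsmul _ _ _ fun d hd => hvec d (Finset.mem_filter.1 hd).2
    _ ≤ (2 ^ nv) ^ w * (Real.exp (L * w) * t ^ (ε / 6 * w) * Fintype.card (Lifting B μ β)) := by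
        rw [nsmul_eq_mul]
        gcongr
    _ = _ := by
        rw [Real.rpow_mul ht0.le, Real.rpow_natCast, mul_comm L, Real.exp_nat_mul]
        ring

/-! ### Summation over the weights -/

/-- The tail sums of the first moment bound tend to zero. -/
theorem tendsto_tsum_weight_bound {K a x : ℝ} (hK : 0 ≤ K) (ha : 0 < a)
    (hsmall : K * x ^ a ≤ 1 / 2) {μ : ℕ} (hμ : 0 < μ) :
    Tendsto (fun β : ℕ => ∑' w : ℕ, if 0 < w ∧ (w : ℝ) < x * (β * μ : ℕ) then
      (K * ((w : ℝ) / (β * μ : ℕ)) ^ a) ^ w else 0) atTop (𝓝 0) := by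
  suffices h : Tendsto _ atTop (𝓝 (∑' _ : ℕ, (0 : ℝ))) by rwa [tsum_zero] at h
  -- Each term vanishes in the limit, as `w` is fixed while `N` grows; below the cutoff `w / N ≤ x`,
  -- so the base is at most `1 / 2`.
  refine tendsto_tsum_of_dominated_convergence (bound := fun w => (1 / 2 : ℝ) ^ w)
    (summable_geometric_of_lt_one (by norm_num) (by norm_num)) (fun w => ?_)
    (Eventually.of_forall fun β w => ?_)
  · obtain rfl | hw := Nat.eq_zero_or_pos w
    · simp
    have hN : Tendsto (fun β : ℕ => ((β * μ : ℕ) : ℝ)) atTop atTop :=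
      tendsto_natCast_atTop_atTop.comp (tendsto_id.atTop_mul_const' hμ)
    have hlim : Tendsto (fun β : ℕ => (K * ((w : ℝ) / (β * μ : ℕ)) ^ a) ^ w) atTop (𝓝 0) := by
      have h1 := (hN.const_div_atTop (w : ℝ)).rpow_const (p := a) (Or.inr ha.le)
      have h2 := (h1.const_mul K).pow w
      simpa [Real.zero_rpow ha.ne', hw.ne'] using h2
    refine squeeze_zero (fun β => ?_) (fun β => ?_) hlim
    · split_ifs <;> positivity
    · split_ifs
      · exact le_rfl
      · exact pow_nonneg (mul_nonneg hK (by positivity)) _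
  · split_ifs with h
    · have hN : (0 : ℝ) < (β * μ : ℕ) := by
        by_contra hcon
        have h0 : ((β * μ : ℕ) : ℝ) = 0 := le_antisymm (not_lt.1 hcon) (Nat.cast_nonneg _)
        rw [h0, mul_zero] at h
        exact absurd h.2 (not_lt.2 (Nat.cast_nonneg w))
      rw [Real.norm_of_nonneg (by positivity)]
      have h1 : (w : ℝ) / (β * μ : ℕ) ≤ x := (div_le_iff₀ hN).2 h.2.le
      gcongr
      refine le_trans ?_ hsmall
      gcongr
    · simp

/-- If the undoped variable nodes of degree two form no cycle, the minimum distance of a typical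
code of the ensemble grows linearly with the block length. -/
theorem hasTypicalMinDist {κ : ℕ} (hC : IsHammingCode κ C)
    (hundoped : ∀ j, j ∉ D → 2 ≤ varDegree B j) (hdoped : ∀ j ∈ D, 1 ≤ varDegree B j)
    (hcycle : NoUndopedDegTwoCycle B D) : HasTypicalMinDist B D C := by
  classical
  have hμ : 0 < μ := by
    obtain ⟨r, hr, hκ, -⟩ := hC
    omega
  obtain ⟨K, a, hK, ha, hbound⟩ := exists_card_codeword_weight_le hC hundoped hdoped hcycle
  -- The solution of `K * x ^ a = 1 / 2`; `x ≤ 1` ensures that weights below `x * N` are at most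
  -- `N`.
  set x : ℝ := (1 / (2 * K)) ^ (1 / a) with hx
  have hx0 : 0 < x := by positivity
  have hx1 : x ≤ 1 := by
    refine Real.rpow_le_one (by positivity) ?_ (by positivity)
    rw [div_le_one (by positivity)]
    linarith
  have hsmall : K * x ^ a ≤ 1 / 2 := by
    rw [hx, ← Real.rpow_mul (by positivity), one_div_mul_cancel ha.ne', Real.rpow_one]
    apply le_of_eq
    field_simp
  -- With `nv + 1` the constant is well defined even for `nv = 0`, and `δ * nv * N ≤ x * N`.
  refine ⟨x / (nv + 1), by positivity, ?_⟩
  refine squeeze_zero (fun β => by unfold liftingProb; positivity) (fun β => ?_)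
    (tendsto_tsum_weight_bound (by linarith) ha hsmall hμ)
  set F : ℕ → ℝ := fun w => if 0 < w ∧ (w : ℝ) < x * (β * μ : ℕ) then
      (K * ((w : ℝ) / (β * μ : ℕ)) ^ a) ^ w else 0 with hF
  have hF0 : ∀ w, 0 ≤ F w := fun w => by
    simp only [hF]
    split_ifs <;> positivity
  have hle : ∀ w : ℕ, (w : ℝ) < x * (β * μ : ℕ) → w ≤ β * μ := fun w hw => by
    have : (w : ℝ) ≤ (β * μ : ℕ) := hw.le.trans (mul_le_of_le_one_left (Nat.cast_nonneg _) hx1)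
    exact_mod_cast this
  have hsupp : ∀ w ∉ Finset.range (β * μ + 1), F w = 0 := fun w hw => by
    refine if_neg fun h => hw ?_
    have := hle w h.2
    exact Finset.mem_range.2 (by omega)
  rw [tsum_eq_sum hsupp]
  have hΩ : (0 : ℝ) < Fintype.card (Lifting B μ β) := by
    exact_mod_cast Fintype.card_pos
  unfold liftingProb
  rw [Nat.card_eq_fintype_card, Nat.card_eq_fintype_card, div_le_iff₀ hΩ, Finset.sum_mul]
  set W := (Finset.range (β * μ + 1)).filter fun w : ℕ => 0 < w ∧ (w : ℝ) < x * (β * μ : ℕ) with hW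
  have hunion : Fintype.card {π : Lifting B μ β // (minDist (code D C π) : ℝ≥0∞)
      < ENNReal.ofReal (x / (nv + 1) * (nv * (β * μ)))}
      ≤ ∑ w ∈ W, Fintype.card {π : Lifting B μ β // ∃ c ∈ code D C π, hammingNorm c = w} := by
    simp only [Fintype.card_subtype]
    refine le_trans (Finset.card_le_card ?_) Finset.card_biUnion_le
    intro π hπ
    obtain ⟨c, hc, hc0, hlt⟩ := exists_codeword_of_minDist_lt (Finset.mem_filter.1 hπ).2
    have hlt' : (hammingNorm c : ℝ) < x * (β * μ : ℕ) := by
      refine hlt.trans_le ?_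
      rw [div_mul_eq_mul_div, div_le_iff₀ (by positivity)]
      push_cast
      have : 0 ≤ x * (β * μ : ℝ) := by positivity
      linarith
    refine Finset.mem_biUnion.2 ⟨hammingNorm c, Finset.mem_filter.2 ⟨Finset.mem_range.2 ?_,
      hammingNorm_pos_iff.2 hc0, hlt'⟩, Finset.mem_filter.2 ⟨Finset.mem_univ _, c, hc, rfl⟩⟩
    have := hle _ hlt'
    omega
  calc _ ≤ ∑ w ∈ W, (Fintype.card
        {π : Lifting B μ β // ∃ c ∈ code D C π, hammingNorm c = w} : ℝ) := by
        exact_mod_cast hunion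
    _ ≤ ∑ w ∈ W, F w * Fintype.card (Lifting B μ β) := by
        refine Finset.sum_le_sum fun w hw => ?_
        obtain ⟨hw0, hwx⟩ := (Finset.mem_filter.1 hw).2
        simp only [hF, if_pos (show 0 < w ∧ (w : ℝ) < x * (β * μ : ℕ) from ⟨hw0, hwx⟩)]
        exact hbound β w hw0 (hle w hwx)
    _ ≤ _ := Finset.sum_le_sum_of_subset_of_nonneg (Finset.filter_subset _ _)
        fun w _ _ => mul_nonneg (hF0 w) hΩ.le

end PDGLDPC

theorem theorem1 {nc nv : ℕ} (B : Matrix (Fin nc) (Fin nv) ℕ) (D : Finset (Fin nv))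
    (μ κ : ℕ) (C : Submodule (ZMod 2) (Fin μ → ZMod 2)) (hC : PDGLDPC.IsHammingCode κ C)
    (hundoped : ∀ j, j ∉ D → 2 ≤ PDGLDPC.varDegree B j)
    (hdoped : ∀ j ∈ D, 1 ≤ PDGLDPC.varDegree B j)
    (hcycle : PDGLDPC.NoUndopedDegTwoCycle B D) :
    PDGLDPC.HasTypicalMinDist B D C :=
  PDGLDPC.hasTypicalMinDist hC hundoped hdoped hcycle
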